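/- Let $\Omega\subset\mathbb R^3$ be open and let $r,s\in(1,\infty)$ with $1/r+1/s=1$. **Notation.** $\mathrm{mat}:\mathbb R^9\to\mathbb R^{3\times3}$ fills a matrix row by row and $\mathrm{vec}=\mathrm{mat}^{-1}$. For $a\in\mathbb R^3$, $\mathrm{smat}(a)$ is the skew-symmetric matrix with $\mathrm{smat}(a)x=a\times x$, and $\mathrm{axl}:\mathfrak{so}(3)\to\mathbb R^3$ is the inverse of $\mathrm{smat}$. For $A=(a_{ij})\in\mathbb R^{3\times3}$ put $$\mathrm{dvec}\,A=(a_{11},a_{22},a_{33})^\top,\quad \mathrm{skvec}\,A=(-a_{23},a_{13},-a_{12})^\top,\quad \mathrm{symvec}\,A=(a_{32},-a_{31},a_{21})^\top .$$ For $Y\in\mathbb R^{3\times3}$ with rows $y_1^\top,y_2^\top,y_3^\top$ and $S_n:=\mathrm{smat}(y_n)$ define the $9\times9$ matrices $$L_{\mathrm{diag},Y}=-\begin{bmatrix}S_1&0&0\\0&S_2&0\\0&0&S_3\end{bmatrix},\quad L_{\mathrm{skew},Y}=\begin{bmatrix}0&-S_3&S_2\\S_3&0&0\\0&0&0\end{bmatrix},\quad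 L_{\mathrm{sym},Y}=\begin{bmatrix}0&0&0\\0&0&-S_1\\-S_2&S_1&0\end{bmatrix},$$ and $L_Y:=L_{\mathrm{skew},Y}+L_{\mathrm{sym},Y}$. For a vector field $v$ in $\mathbb R^3$, $\hat\nabla v:=\mathrm{vec}\,\nabla v$, where the rows of $\nabla v$ are the (weak) gradients of the components of $v$. $\mathrm{Curl}$ of a matrix field is the row-wise curl in the sense of distributions, and $W^p(\mathrm{Curl};\Omega):=\{Y\in L^p(\Omega;\mathbb R^{3\times3}):\mathrm{Curl}\,Y\in L^p(\Omega;\mathbb R^{3\times3})\}$. **Lemma.** Let $X\in W^{1,r}(\Omega;\mathbb R^{3\times3})$ and $Y\in W^s(\mathrm{Curl};\Omega)$. Then $XY\in W^1(\mathrm{Curl};\Omega)$, the vector fields $\mathrm{dvec}\,X,\mathrm{skvec}\,X,\mathrm{symvec}\,X$ belong to $W^{1,r}(\Omega;\mathbb R^3)$, the fields $L_{\mathrm{diag},Y},L_{\mathrm{skew},Y},L_{\mathrm{sym},Y}$ belong to $L^s(\Omega;\mathbb R^{9\times9})$, and $$\mathrm{Curl}(XY)=\mathrm{mat}\big(L_{\mathrm{diag},Y}\hat\nabla\,\mathrm{dvec}\,X+L_{\mathrm{skew},Y}\hat\nabla\,\mathrm{skvec}\,X+L_{\mathrm{sym},Y}\hat\nabla\,\mathrm{symvec}\,X\big)+X\,\mathrm{Curl}\,Y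 .$$ If $X$ is skew-symmetric almost everywhere in $\Omega$, then $\mathrm{axl}\,X\in W^{1,r}(\Omega;\mathbb R^3)$ and $$\mathrm{Curl}(XY)=\mathrm{mat}\big(L_Y\hat\nabla\,\mathrm{axl}\,X\big)+X\,\mathrm{Curl}\,Y .$$ Moreover $\det L_Y=-2(\det Y)^3$ for every $Y\in\mathbb R^{3\times3}$; hence $L_Y$ is invertible whenever $Y$ is. -/

import Mathlib

open MeasureTheory
open scoped ContDiff

namespace NeffCurl

/-- The space `ℝ³`, on which the fields are defined. -/
abbrev E3 : Type := EuclideanSpace ℝ (Fin 3)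

/-- Real `3 × 3` matrices. -/
abbrev M3 : Type := Matrix (Fin 3) (Fin 3) ℝ

/-! ### Linear algebra -/

/-- `mat : ℝ⁹ → ℝ³ˣ³`, filling the matrix row by row
(`finProdFinEquiv (i, j)` is the index `3 * i + j`). -/
def mat (a : Fin 9 → ℝ) : M3 := Matrix.of fun i j => a (finProdFinEquiv (m := 3) (n := 3) (i, j))

/-- `vec : ℝ³ˣ³ → ℝ⁹`, the inverse of `mat`. -/
def vec (A : M3) : Fin 9 → ℝ := fun k =>
  A ((finProdFinEquiv (m := 3) (n := 3)).symm k).1 ((finProdFinEquiv (m := 3) (n := 3)).symm k).2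

theorem mat_eq (a : Fin 9 → ℝ) :
    mat a = !![a 0, a 1, a 2; a 3, a 4, a 5; a 6, a 7, a 8] := by
  ext i j
  fin_cases i <;> fin_cases j <;> rfl

theorem mat_vec (A : M3) : mat (vec A) = A := by
  ext i j
  simp [mat, vec]

theorem vec_mat (a : Fin 9 → ℝ) : vec (mat a) = a := by
  ext k
  simp only [mat, vec, Matrix.of_apply, Prod.mk.eta, Equiv.apply_symm_apply]

/-- The skew-symmetric matrix `smat a` with `smat a *ᵥ x = a × x`. -/
def smat (a : Fin 3 → ℝ) : M3 :=
  !![0, -a 2, a 1;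
     a 2, 0, -a 0;
     -a 1, a 0, 0]

/-- The axial vector of a skew-symmetric matrix: on `so(3)` this is the inverse of `smat`,
see `axl_smat` and `smat_axl`. (It is used for skew-symmetric matrices only.) -/
def axl (A : M3) : Fin 3 → ℝ := ![A 2 1, A 0 2, A 1 0]

/-- The diagonal entries. -/
def dvec (A : M3) : Fin 3 → ℝ := ![A 0 0, A 1 1, A 2 2]

/-- The entries above the diagonal, arranged and signed so that `skvec = axl` on `so(3)`. -/
def skvec (A : M3) : Fin 3 → ℝ := ![-A 1 2, A 0 2, -A 0 1]

/-- The entries below the diagonal, arranged and signed so that `symvec = axl` on `so(3)`. -/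
def symvec (A : M3) : Fin 3 → ℝ := ![A 2 1, -A 2 0, A 1 0]

theorem axl_smat (a : Fin 3 → ℝ) : axl (smat a) = a := by
  ext i
  fin_cases i <;> rfl

theorem smat_axl (A : M3) (hA : A.transpose = -A) : smat (axl A) = A := by
  have h : ∀ i j, A j i = -A i j := fun i j => congrFun (congrFun hA i) j
  ext i j
  fin_cases i <;> fin_cases j <;> simp [smat, axl] <;>
    linarith [h 0 0, h 1 1, h 2 2, h 0 1, h 0 2, h 1 2]

/-- The `9 × 9` matrix made of `3 × 3` blocks of size `3 × 3`. -/
def blocks (B : Matrix (Fin 3) (Fin 3) M3) : Matrix (Fin 9) (Fin 9) ℝ :=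
  Matrix.reindex (finProdFinEquiv (m := 3) (n := 3)) (finProdFinEquiv (m := 3) (n := 3))
    (Matrix.of fun p q : Fin 3 × Fin 3 => B p.1 q.1 p.2 q.2)

/-- `L_{diag,Y}`; here `Y n` is the `n`-th row of `Y`. -/
def Ldiag (Y : M3) : Matrix (Fin 9) (Fin 9) ℝ :=
  -blocks !![smat (Y 0), 0, 0;
             0, smat (Y 1), 0;
             0, 0, smat (Y 2)]

/-- `L_{skew,Y}`. -/
def Lskew (Y : M3) : Matrix (Fin 9) (Fin 9) ℝ :=
  blocks !![0, -smat (Y 2), smat (Y 1);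
            smat (Y 2), 0, 0;
            0, 0, 0]

/-- `L_{sym,Y}`. -/
def Lsym (Y : M3) : Matrix (Fin 9) (Fin 9) ℝ :=
  blocks !![0, 0, 0;
            0, 0, -smat (Y 0);
            -smat (Y 1), smat (Y 0), 0]

/-- `L_Y = L_{skew,Y} + L_{sym,Y}`. -/
def LY (Y : M3) : Matrix (Fin 9) (Fin 9) ℝ := Lskew Y + Lsym Y

/-! ### Function spaces and weak derivatives on an open set `Ω ⊆ ℝ³` -/

/-- `φ ∈ C_c^∞(Ω)`. -/
def IsTest (Ω : Set E3) (φ : E3 → ℝ) : Prop :=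
  ContDiff ℝ ∞ φ ∧ HasCompactSupport φ ∧ tsupport φ ⊆ Ω

/-- The classical partial derivative `∂ᵢ φ`. -/
noncomputable def pd (i : Fin 3) (φ : E3 → ℝ) (x : E3) : ℝ :=
  fderiv ℝ φ x (EuclideanSpace.single i 1)

/-- `g` is the weak partial derivative `∂ᵢ u` on `Ω`. -/
def HasWeakPartial (Ω : Set E3) (i : Fin 3) (u g : E3 → ℝ) : Prop :=
  LocallyIntegrableOn u Ω ∧ LocallyIntegrableOn g Ω ∧
    ∀ φ, IsTest Ω φ → ∫ x in Ω, u x * pd i φ x = -∫ x in Ω, g x * φ x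

/-- `J` is the weak Jacobian `∇v` on `Ω`: row `i` is the gradient of the component `v i`. -/
def HasWeakJacobian (Ω : Set E3) (v : E3 → Fin 3 → ℝ) (J : E3 → M3) : Prop :=
  ∀ i j, HasWeakPartial Ω j (fun x => v x i) (fun x => J x i j)

/-- `w = curl v` on `Ω` in the sense of distributions, i.e.
`w k = ∂ (k+1) (v (k+2)) - ∂ (k+2) (v (k+1))`, with indices modulo `3`.
(The individual derivatives of `v` need not be functions.) -/
def HasWeakCurlVec (Ω : Set E3) (v w : E3 → Fin 3 → ℝ) : Prop :=
  (∀ k, LocallyIntegrableOn (fun x => v x k) Ω) ∧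
  (∀ k, LocallyIntegrableOn (fun x => w x k) Ω) ∧
    ∀ k φ, IsTest Ω φ →
      ∫ x in Ω, (v x (k + 2) * pd (k + 1) φ x - v x (k + 1) * pd (k + 2) φ x)
        = -∫ x in Ω, w x k * φ x

/-- `Z = Curl Y` on `Ω` weakly: the weak `curl`, row by row. -/
def HasWeakCurl (Ω : Set E3) (Y Z : E3 → M3) : Prop :=
  ∀ l, HasWeakCurlVec Ω (fun x => Y x l) (fun x => Z x l)

/-- `F ∈ Lᵖ(Ω; ℝᵐˣⁿ)`. -/
def MemLpMat {m n : ℕ} (Ω : Set E3) (p : ENNReal) (F : E3 → Matrix (Fin m) (Fin n) ℝ) : Prop :=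
  ∀ i j, MemLp (fun x => F x i j) p (volume.restrict Ω)

/-- `u ∈ W^{1,p}(Ω)`. -/
def MemW1 (Ω : Set E3) (p : ENNReal) (u : E3 → ℝ) : Prop :=
  MemLp u p (volume.restrict Ω) ∧
    ∀ i, ∃ g, MemLp g p (volume.restrict Ω) ∧ HasWeakPartial Ω i u g

/-- `Y ∈ W^p(Curl; Ω; ℝ³ˣ³)`, i.e. `Y ∈ Lᵖ(Ω)` and `Curl Y ∈ Lᵖ(Ω)`. -/
def MemWCurl (Ω : Set E3) (p : ENNReal) (Y : E3 → M3) : Prop :=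
  MemLpMat Ω p Y ∧ ∃ Z, MemLpMat Ω p Z ∧ HasWeakCurl Ω Y Z

end NeffCurl

open NeffCurl

/-! Row `l` of `XY` is `∑ₙ Xₗₙ yₙ`, so the formula reduces to `curl (u y) = ∇u × y + u curl y` for
`u` in `W^{1,r}` and `y`, `curl y` in `L^s`. This holds because `uφ`, for a test function `φ`, may
itself be used to test `curl y`: its derivatives `φ ∂u + u ∂φ` give both terms
(`HasWeakCurlVec.smul`).

That `uφ` is admissible is `integral_eq_of_forall_isTest`. Instead of letting mollifications
converge in `L^r`, it considers the defect `H t` of the identity for the translate of `uφ` by `t`.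
Fubini and the identity for mollified functions give `∫ η H = 0` for every smooth `η` supported near
`0`. As `r < ∞`, translations are strongly continuous, so `H` is continuous and `H 0 = 0`. The block
matrices then merely reorder the cross products `∇Xₗₙ × yₙ` (`mat_mulVec_add_apply`).

For the determinant, `L_Y = ∑ₙ smat eₙ ⊗ smat yₙ`. The rule `M smat(Mᵀy) Mᵀ = det M • smat y`
reduces invertible `Y` to `Y = 1`, where `L_Y` is `V ↦ (tr V) 1 - Vᵀ` with determinant `-2`. Density
covers singular `Y`. -/

namespace NeffCurl
-- Translations and mollification on the whole space.
open scoped Convolution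
open ContinuousLinearMap Filter Topology

/-- Pairing with translates is continuous in the translation. -/
theorem continuous_integral_mul_translate {p q : ENNReal} [p.HolderConjugate q] (hq : q ≠ ⊤)
    {f g : E3 → ℝ} (hf : MemLp f p) (hg : MemLp g q) :
    Continuous fun t => ∫ x, f x * g (x - t) := by
  have : Fact (1 ≤ p) := ⟨ENNReal.HolderConjugate.one_le p q⟩
  have : Fact (1 ≤ q) := ⟨ENNReal.HolderConjugate.one_le q p⟩
  let τ : C(E3, C(E3, E3)) :=
    (ContinuousMap.mk (fun a : E3 × E3 => a.2 - a.1) (by fun_prop)).curry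
  have hτ : ∀ t, MeasurePreserving (τ t) volume volume := fun t =>
    measurePreserving_sub_right volume t
  -- As a duality pairing with a translate of a fixed class in `L^q`, this inherits the strong
  -- continuity of translations, which needs `q < ∞`.
  have key : (fun t => ∫ x, f x * g (x - t)) = fun t =>
      (mul ℝ ℝ).lpPairing volume p q (hf.toLp f)
        (Lp.compMeasurePreserving (τ t) (hτ t) (hg.toLp g)) := by
    funext t
    rw [lpPairing_eq_integral]
    refine integral_congr_ae ?_
    filter_upwards [hf.coeFn_toLp, Lp.coeFn_compMeasurePreserving (hg.toLp g) (hτ t),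
      (hτ t).quasiMeasurePreserving.ae_eq_comp hg.coeFn_toLp] with x h1 h2 h3
    rw [h1, h2, h3]
    rfl
  rw [key]
  exact ((mul ℝ ℝ).lpPairing volume p q (hf.toLp f)).continuous.comp
    (continuous_const.compMeasurePreservingLp τ.continuous hτ hq)

theorem integrable_mul_translate {p q : ENNReal} [p.HolderConjugate q]
    {f g : E3 → ℝ} (hf : MemLp f p) (hg : MemLp g q) (t : E3) :
    Integrable fun x => f x * g (x - t) :=
  hf.integrable_mul (hg.comp_measurePreserving (measurePreserving_sub_right volume t))

theorem convolution_mul_apply (g η : E3 → ℝ) (x : E3) :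
    (g ⋆[mul ℝ ℝ, volume] η) x = ∫ t, η t * g (x - t) := by
  rw [convolution_eq_swap]
  simp [mul_comm]

/-- Fubini for the pairing with a mollified function. -/
theorem integrable_and_integral_mul_convolution {p q : ENNReal} [p.HolderConjugate q]
    (hq : q ≠ ⊤) {f g η : E3 → ℝ} (hf : MemLp f p) (hg : MemLp g q) (hη : Continuous η)
    (hηc : HasCompactSupport η) :
    Integrable (fun x => f x * (g ⋆[mul ℝ ℝ, volume] η) x) ∧
      ∫ x, f x * (g ⋆[mul ℝ ℝ, volume] η) x = ∫ t, η t * ∫ x, f x * g (x - t) := by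
  have hint : Integrable (fun z : E3 × E3 => f z.1 * (η z.2 * g (z.1 - z.2)))
      (volume.prod volume) := by
    have hmeas : AEStronglyMeasurable (fun z : E3 × E3 => f z.1 * (η z.2 * g (z.1 - z.2)))
        (volume.prod volume) :=
      hf.1.comp_fst.mul
        (AEStronglyMeasurable.convolution_integrand (mul ℝ ℝ) hη.aestronglyMeasurable hg.1)
    rw [integrable_prod_iff' hmeas]
    constructor
    · refine .of_forall fun t => ?_
      refine ((integrable_mul_translate hf hg t).const_mul (η t)).congr (.of_forall fun x => ?_)
      simp only
      ring
    · have h : (fun t => ∫ x, ‖f x * (η t * g (x - t))‖) =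
          fun t => |η t| * ∫ x, |f x| * |g (x - t)| := by
        funext t
        rw [← integral_const_mul]
        refine integral_congr_ae (.of_forall fun x => ?_)
        simp only [norm_mul, Real.norm_eq_abs]
        ring
      simp only [h]
      refine Continuous.integrable_of_hasCompactSupport ?_ ?_
      · exact hη.abs.mul (continuous_integral_mul_translate hq hf.norm hg.norm)
      · exact HasCompactSupport.mul_right (f := fun t => |η t|) (hηc.norm)
  have hfst : (fun x => ∫ t, f x * (η t * g (x - t))) =
      fun x => f x * (g ⋆[mul ℝ ℝ, volume] η) x := by
    funext x
    rw [integral_const_mul, convolution_mul_apply]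
  refine ⟨hfst ▸ hint.integral_prod_left, ?_⟩
  rw [← hfst, integral_integral_swap hint]
  refine integral_congr_ae (.of_forall fun t => ?_)
  simp only
  rw [← integral_const_mul]
  refine integral_congr_ae (.of_forall fun x => ?_)
  simp only
  ring

/-- Weak differentiation commutes with mollification. -/
theorem pd_convolution {j : Fin 3} {ψ g η : E3 → ℝ} (h : HasWeakPartial Set.univ j ψ g)
    (hη : ContDiff ℝ ∞ η) (hηc : HasCompactSupport η) :
    pd j (ψ ⋆[mul ℝ ℝ, volume] η) = g ⋆[mul ℝ ℝ, volume] η := by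
  funext x
  have hψ : LocallyIntegrable ψ := locallyIntegrableOn_univ.1 h.1
  have hη1 : ContDiff ℝ 1 η := hη.of_le (by exact_mod_cast le_top)
  have hd := (hηc.hasFDerivAt_convolution_right (mul ℝ ℝ) hψ hη1 x).fderiv
  -- Testing with the reflected `η` gives a sign that cancels the one from integration by parts.
  have htest : IsTest Set.univ fun t => η (x - t) := by
    refine ⟨hη.comp (contDiff_const.sub contDiff_id), ?_, Set.subset_univ _⟩
    exact hηc.comp_homeomorph (Homeomorph.subLeft x)
  have hpd : ∀ t, pd j (fun t => η (x - t)) t = -fderiv ℝ η (x - t) (EuclideanSpace.single j 1) := by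
    intro t
    have h1 : HasFDerivAt (fun t : E3 => η (x - t))
        ((fderiv ℝ η (x - t)).comp (-ContinuousLinearMap.id ℝ E3)) t :=
      HasFDerivAt.comp t (hη1.differentiable one_ne_zero (x - t)).hasFDerivAt
        ((hasFDerivAt_id t).const_sub x)
    simp [pd, h1.fderiv]
  have hw := h.2.2 _ htest
  simp only [hpd, Measure.restrict_univ] at hw
  rw [pd, hd, convolution_precompR_apply (mul ℝ ℝ) hψ (hηc.fderiv ℝ)
    (hη1.continuous_fderiv one_ne_zero)]
  simp only [convolution_def, mul_apply']
  simp only [mul_neg, integral_neg, neg_inj] at hw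
  exact hw

end NeffCurl

/-! ### The determinant of `L_Y`. -/

namespace NeffCurl
open Matrix
open scoped Kronecker

/-- The matrices of `x ↦ eₙ × x`, with integer entries. -/
def crossTable : Fin 3 → Matrix (Fin 3) (Fin 3) ℤ :=
  ![!![0, 0, 0; 0, 0, -1; 0, 1, 0], !![0, 0, 1; 0, 0, 0; -1, 0, 0],
    !![0, -1, 0; 1, 0, 0; 0, 0, 0]]

theorem smat_single (n : Fin 3) : smat (Pi.single n 1) = (crossTable n).map Int.cast := by
  have h1 : (-1 : ℝ) = ((-1 : ℤ) : ℝ) := by norm_num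
  fin_cases n <;> simp [smat, crossTable] <;> ext i j <;> fin_cases i <;> fin_cases j <;>
    first | exact Int.cast_zero.symm | exact Int.cast_one.symm | exact h1

/-- The contraction identity of the Levi-Civita symbol; integer entries make it decidable. -/
theorem sum_crossTable_mul : ∀ i j a b : Fin 3, ∑ n, crossTable n i j * crossTable n a b =
    (if i = a ∧ j = b then 1 else 0) - (if a = j ∧ i = b then 1 else 0) := by
  decide

/-- `L_Y` before the identification of `Fin 3 × Fin 3` with `Fin 9`. -/
noncomputable def kroneckerLY (Y : M3) : Matrix (Fin 3 × Fin 3) (Fin 3 × Fin 3) ℝ :=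
  ∑ n, (crossTable n).map Int.cast ⊗ₖ smat (Y.row n)

theorem block_add_block_apply (A B C : M3) (i j a b : Fin 3) :
    (!![0, -C, B; C, 0, 0; 0, 0, 0] : Matrix (Fin 3) (Fin 3) M3) i j a b +
      (!![0, 0, 0; 0, 0, -A; -B, A, 0] : Matrix (Fin 3) (Fin 3) M3) i j a b =
      (crossTable 0 i j : ℝ) * A a b + crossTable 1 i j * B a b + crossTable 2 i j * C a b := by
  fin_cases i <;> fin_cases j
  · change (0 : M3) a b + (0 : M3) a b =
      ((0 : ℤ) : ℝ) * A a b + ((0 : ℤ) : ℝ) * B a b + ((0 : ℤ) : ℝ) * C a b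
    simp
  · change (-C : M3) a b + (0 : M3) a b =
      ((0 : ℤ) : ℝ) * A a b + ((0 : ℤ) : ℝ) * B a b + ((-1 : ℤ) : ℝ) * C a b
    simp
  · change (B : M3) a b + (0 : M3) a b =
      ((0 : ℤ) : ℝ) * A a b + ((1 : ℤ) : ℝ) * B a b + ((0 : ℤ) : ℝ) * C a b
    simp
  · change (C : M3) a b + (0 : M3) a b =
      ((0 : ℤ) : ℝ) * A a b + ((0 : ℤ) : ℝ) * B a b + ((1 : ℤ) : ℝ) * C a b
    simp
  · change (0 : M3) a b + (0 : M3) a b =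
      ((0 : ℤ) : ℝ) * A a b + ((0 : ℤ) : ℝ) * B a b + ((0 : ℤ) : ℝ) * C a b
    simp
  · change (0 : M3) a b + (-A : M3) a b =
      ((-1 : ℤ) : ℝ) * A a b + ((0 : ℤ) : ℝ) * B a b + ((0 : ℤ) : ℝ) * C a b
    simp
  · change (0 : M3) a b + (-B : M3) a b =
      ((0 : ℤ) : ℝ) * A a b + ((-1 : ℤ) : ℝ) * B a b + ((0 : ℤ) : ℝ) * C a b
    simp
  · change (0 : M3) a b + (A : M3) a b =
      ((1 : ℤ) : ℝ) * A a b + ((0 : ℤ) : ℝ) * B a b + ((0 : ℤ) : ℝ) * C a b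
    simp
  · change (0 : M3) a b + (0 : M3) a b =
      ((0 : ℤ) : ℝ) * A a b + ((0 : ℤ) : ℝ) * B a b + ((0 : ℤ) : ℝ) * C a b
    simp

theorem LY_eq_reindex (Y : M3) :
    LY Y = Matrix.reindex (finProdFinEquiv (m := 3) (n := 3)) (finProdFinEquiv (m := 3) (n := 3))
      (kroneckerLY Y) := by
  ext k l
  obtain ⟨⟨i, a⟩, rfl⟩ := (finProdFinEquiv (m := 3) (n := 3)).surjective k
  obtain ⟨⟨j, b⟩, rfl⟩ := (finProdFinEquiv (m := 3) (n := 3)).surjective l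
  rw [kroneckerLY, Fin.sum_univ_three]
  simp only [LY, Lskew, Lsym, blocks, Matrix.add_apply, Matrix.reindex_apply,
    Matrix.submatrix_apply, Equiv.symm_apply_apply, Matrix.of_apply, kroneckerMap_apply,
    Matrix.map_apply]
  exact block_add_block_apply _ _ _ i j a b

theorem det_LY_eq (Y : M3) : (LY Y).det = (kroneckerLY Y).det := by
  rw [LY_eq_reindex, Matrix.det_reindex_self]

/-- Paired with `u` and `w`, both sides are triple products: `det(Mᵀu, Mᵀy, Mᵀw) = det M · det(u, y,
w)`. Hence `M` may be singular. -/
theorem mul_smat_mul_transpose (M : M3) (y : Fin 3 → ℝ) :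
    M * smat (y ᵥ* M) * Mᵀ = M.det • smat y := by
  ext i j
  fin_cases i <;> fin_cases j <;>
    simp [smat, Matrix.mul_apply, Fin.sum_univ_three, Matrix.det_fin_three, Matrix.vecMul,
      dotProduct] <;> ring

theorem kroneckerLY_mul (Y M : M3) :
    ((1 : M3) ⊗ₖ M) * kroneckerLY (Y * M) * ((1 : M3) ⊗ₖ Mᵀ) = M.det • kroneckerLY Y := by
  simp only [kroneckerLY, Finset.mul_sum, Finset.sum_mul, Finset.smul_sum, ← mul_kronecker_mul,
    one_mul, mul_one]
  refine Finset.sum_congr rfl fun n _ => ?_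
  rw [← kronecker_smul, ← mul_smat_mul_transpose M (Y.row n)]
  rfl

theorem kroneckerLY_one_apply (i j a b : Fin 3) :
    kroneckerLY 1 (i, a) (j, b) =
      (if i = a ∧ j = b then 1 else 0) - (if a = j ∧ i = b then 1 else 0) := by
  have hrow : ∀ n, (1 : M3).row n = Pi.single n 1 := fun n => by
    ext k
    simp [Matrix.one_apply, Pi.single_apply, eq_comm]
  simp only [kroneckerLY, hrow, smat_single, Matrix.sum_apply, kroneckerMap_apply,
    Matrix.map_apply]
  exact_mod_cast sum_crossTable_mul i j a b

/-- Swapping the two row indices removes the transpose from `V ↦ (tr V) 1 - Vᵀ`. What remains is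
minus a rank-one perturbation of the identity, built from `vec 1`. -/
theorem kroneckerLY_one_submatrix :
    (kroneckerLY 1).submatrix (Equiv.prodComm (Fin 3) (Fin 3)) id =
      -(1 + replicateCol Unit (fun p : Fin 3 × Fin 3 => if p.1 = p.2 then (-1 : ℝ) else 0) *
        replicateRow Unit (fun p : Fin 3 × Fin 3 => if p.1 = p.2 then (1 : ℝ) else 0)) := by
  ext ⟨i, a⟩ ⟨j, b⟩
  simp only [submatrix_apply, Equiv.prodComm_apply, Prod.swap_prod_mk, id,
    kroneckerLY_one_apply, Matrix.neg_apply,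
    Matrix.add_apply, Matrix.one_apply, Matrix.mul_apply, replicateCol_apply,
    replicateRow_apply, Finset.univ_unique, Finset.sum_singleton, Prod.mk.injEq]
  by_cases h1 : a = i <;> by_cases h2 : j = b <;> by_cases h3 : i = j <;>
    by_cases h4 : a = b <;> simp_all <;> grind

theorem det_kroneckerLY_one : (kroneckerLY 1).det = -2 := by
  have h := congrArg Matrix.det kroneckerLY_one_submatrix
  -- The swap consists of three transpositions. The other factors are `(-1)⁹` and `1 - 3`.
  have hs : Equiv.Perm.sign (Equiv.prodComm (Fin 3) (Fin 3)) = -1 := by decide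
  rw [det_permute, hs, det_neg, det_one_add_replicateCol_mul_replicateRow] at h
  simp [dotProduct, Fintype.sum_prod_type] at h
  norm_num at h
  linarith

theorem det_LY_of_det_ne_zero (Y : M3) (hY : Y.det ≠ 0) : (LY Y).det = -2 * Y.det ^ 3 := by
  -- With `d = det Y` this reads `d⁻³ · (-2) · d⁻³ = d⁻⁹ · det L_Y`.
  have h := congrArg Matrix.det (kroneckerLY_mul Y Y⁻¹)
  have hu : IsUnit Y.det := isUnit_iff_ne_zero.2 hY
  rw [Matrix.mul_nonsing_inv Y hu, det_mul, det_mul, det_kronecker, det_kronecker,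
    det_kroneckerLY_one, det_smul, ← det_LY_eq, det_transpose, det_nonsing_inv,
    Ring.inverse_eq_inv'] at h
  simp only [det_one, one_pow, one_mul, Fintype.card_fin, Fintype.card_prod] at h
  have h9 : Y.det⁻¹ ^ (3 * 3) * Y.det ^ 9 = 1 := by
    rw [← mul_pow, inv_mul_cancel₀ hY, one_pow]
  have h6 : Y.det⁻¹ ^ 6 * Y.det ^ 6 = 1 := by
    rw [← mul_pow, inv_mul_cancel₀ hY, one_pow]
  linear_combination (-(Y.det ^ 9)) * h - (LY Y).det * h9 - 2 * Y.det ^ 3 * h6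

theorem continuous_smat : Continuous smat := by
  refine continuous_matrix fun i j => ?_
  fin_cases i <;> fin_cases j <;> simp [smat] <;> fun_prop

theorem continuous_det_LY : Continuous fun Y : M3 => (LY Y).det := by
  simp only [det_LY_eq]
  refine Continuous.matrix_det ?_
  unfold kroneckerLY
  refine continuous_finsetSum _ fun n _ => continuous_matrix fun p q => ?_
  simp only [kroneckerMap_apply]
  have : Continuous fun Y : M3 => smat (Y.row n) := continuous_smat.comp (continuous_apply n)
  exact continuous_const.mul (this.matrix_elem p.2 q.2)

theorem det_LY (Y : M3) : (LY Y).det = -2 * Y.det ^ 3 := by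
  -- This is `t • 1 + Y`, written so that its determinant is the characteristic polynomial of `-Y`
  -- at `t`. It vanishes for finitely many `t` only, and continuity carries the identity to `t = 0`.
  let P : ℝ → M3 := fun t => scalar (Fin 3) t - -Y
  have hP : Continuous P := by
    refine Continuous.sub (continuous_matrix fun i j => ?_) continuous_const
    simp only [scalar_apply, diagonal_apply]
    split_ifs <;> fun_prop
  have hfin : {t : ℝ | (P t).det = 0}.Finite := by
    refine (Multiset.finite_toSet (-Y).charpoly.roots).subset fun t ht => ?_
    have : (-Y).charpoly.eval t = 0 := by rw [eval_charpoly]; exact ht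
    exact (Polynomial.mem_roots (-Y).charpoly_monic.ne_zero).2 this
  have heq : (fun t => (LY (P t)).det) = fun t => -2 * (P t).det ^ 3 :=
    Continuous.ext_on (hfin.countable.dense_compl ℝ) (continuous_det_LY.comp hP)
      (continuous_const.mul (hP.matrix_det.pow 3)) fun t ht => det_LY_of_det_ne_zero (P t) ht
  have h0 : P 0 = Y := by simp [P]
  simpa only [h0] using congrFun heq 0

end NeffCurl

/-! ### Sobolev test functions, the product rule for the curl, and uniqueness of weak derivatives.
-/

namespace NeffCurl
open scoped Convolution
open ContinuousLinearMap Filter Topology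

/-- A mollification with small support of a function with compact support in `Ω` is a test
function. -/
theorem isTest_convolution {Ω : Set E3} {ψ η : E3 → ℝ} {δ : ℝ} (hψ : LocallyIntegrable ψ)
    (hψc : HasCompactSupport ψ) (hδ : Metric.cthickening δ (tsupport ψ) ⊆ Ω)
    (hη : ContDiff ℝ ∞ η) (hηc : HasCompactSupport η)
    (hηδ : Function.support η ⊆ Metric.closedBall 0 δ) :
    IsTest Ω (ψ ⋆[mul ℝ ℝ, volume] η) := by
  refine ⟨hηc.contDiff_convolution_right (mul ℝ ℝ) hψ hη, hψc.convolution (mul ℝ ℝ) hηc, ?_⟩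
  refine subset_trans (closure_minimal ?_ Metric.isClosed_cthickening) hδ
  refine (support_convolution_subset (mul ℝ ℝ)).trans ?_
  rintro _ ⟨x, hx, y, hy, rfl⟩
  refine Metric.mem_cthickening_of_dist_le _ x _ _ (subset_tsupport _ hx) ?_
  simpa using hηδ hy

theorem integral_indicator_mul {Ω : Set E3} (hΩ : MeasurableSet Ω) (f k : E3 → ℝ) :
    ∫ x, Ω.indicator f x * k x = ∫ x in Ω, f x * k x := by
  rw [← integral_indicator hΩ]
  refine integral_congr_ae (.of_forall fun x => ?_)
  simp only [Set.indicator_mul_left]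

/-- A first order identity that holds for test functions holds for Sobolev functions with compact
support. -/
theorem integral_eq_of_forall_isTest {Ω : Set E3} (hΩ : IsOpen Ω) {p q : ENNReal}
    [p.HolderConjugate q] (hq : q ≠ ⊤) {a b : Fin 3} {f₁ f₂ f₃ : E3 → ℝ}
    (h₁ : MemLp f₁ p (volume.restrict Ω)) (h₂ : MemLp f₂ p (volume.restrict Ω))
    (h₃ : MemLp f₃ p (volume.restrict Ω))
    (h : ∀ φ, IsTest Ω φ →
      ∫ x in Ω, (f₁ x * pd a φ x - f₂ x * pd b φ x) = -∫ x in Ω, f₃ x * φ x)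
    {ψ ga gb : E3 → ℝ} (hψ : MemLp ψ q) (hga : MemLp ga q) (hgb : MemLp gb q)
    (ha : HasWeakPartial Set.univ a ψ ga) (hb : HasWeakPartial Set.univ b ψ gb)
    (hψc : HasCompactSupport ψ) (hψΩ : tsupport ψ ⊆ Ω) :
    ∫ x in Ω, (f₁ x * ga x - f₂ x * gb x) = -∫ x in Ω, f₃ x * ψ x := by
  have hm := hΩ.measurableSet
  rw [← memLp_indicator_iff_restrict hm] at h₁ h₂ h₃
  -- The defect for the translated `ψ`; extension by zero lets it be defined for every `t`.
  let H : E3 → ℝ := fun t => (∫ x, Ω.indicator f₁ x * ga (x - t)) -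
    (∫ x, Ω.indicator f₂ x * gb (x - t)) + ∫ x, Ω.indicator f₃ x * ψ (x - t)
  have c₁ := continuous_integral_mul_translate hq h₁ hga
  have c₂ := continuous_integral_mul_translate hq h₂ hgb
  have c₃ := continuous_integral_mul_translate hq h₃ hψ
  have hH : Continuous H := (c₁.sub c₂).add c₃
  obtain ⟨δ, hδ0, hδ⟩ := hψc.isCompact.exists_cthickening_subset_open hΩ hψΩ
  have hzero : ∀ η : E3 → ℝ, ContDiff ℝ ∞ η → HasCompactSupport η →
      Function.support η ⊆ Metric.closedBall 0 δ → ∫ t, η t * H t = 0 := by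
    intro η hη hηc hηδ
    have hint : ∀ {k : E3 → ℝ}, Continuous k → Integrable fun t => η t * k t := fun hk =>
      (hη.continuous.mul hk).integrable_of_hasCompactSupport hηc.mul_right
    obtain ⟨i₁, e₁⟩ := integrable_and_integral_mul_convolution hq h₁ hga hη.continuous hηc
    obtain ⟨i₂, e₂⟩ := integrable_and_integral_mul_convolution hq h₂ hgb hη.continuous hηc
    obtain ⟨i₃, e₃⟩ := integrable_and_integral_mul_convolution hq h₃ hψ hη.continuous hηc
    have htest := h _ (isTest_convolution (locallyIntegrableOn_univ.1 ha.1) hψc hδ hη hηc hηδ)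
    rw [pd_convolution ha hη hηc, pd_convolution hb hη hηc, ← integral_indicator_mul hm f₃] at htest
    have hsub : ∫ x in Ω, (f₁ x * (ga ⋆[mul ℝ ℝ, volume] η) x -
        f₂ x * (gb ⋆[mul ℝ ℝ, volume] η) x) =
        (∫ x, Ω.indicator f₁ x * (ga ⋆[mul ℝ ℝ, volume] η) x) -
          ∫ x, Ω.indicator f₂ x * (gb ⋆[mul ℝ ℝ, volume] η) x := by
      rw [← integral_sub i₁ i₂, ← integral_indicator hm]
      refine integral_congr_ae (.of_forall fun x => ?_)
      by_cases hx : x ∈ Ω <;> simp [hx]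
    rw [hsub, e₁, e₂, e₃] at htest
    simp only [H, mul_add, mul_sub]
    have hs : Integrable fun t => (η t * ∫ x, Ω.indicator f₁ x * ga (x - t)) -
        η t * ∫ x, Ω.indicator f₂ x * gb (x - t) := (hint c₁).sub (hint c₂)
    rw [integral_add hs (hint c₃), integral_sub (hint c₁) (hint c₂), htest]
    ring
  have hH0 : H 0 = 0 := by
    -- The averages of `H` against these bumps vanish once the outer radius is below `δ`, and they
    -- tend to `H 0`. Composing `H` with negation undoes the reflection in the convolution.
    let φ : ℕ → ContDiffBump (0 : E3) := fun n =>
      { rIn := 1 / (n + 1) / 2, rOut := 1 / (n + 1), rIn_pos := by positivity,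
        rIn_lt_rOut := half_lt_self (by positivity) }
    have hφ : Tendsto (fun n => (φ n).rOut) atTop (𝓝 0) := tendsto_one_div_add_atTop_nhds_zero_nat
    have hlim := ContDiffBump.convolution_tendsto_right_of_continuous (μ := volume) hφ
      (hH.comp continuous_neg) 0
    have hev : ∀ᶠ n in atTop,
        ((φ n).normed volume ⋆[lsmul ℝ ℝ, volume] (H ∘ Neg.neg)) 0 = 0 := by
      filter_upwards [hφ.eventually (gt_mem_nhds hδ0)] with n hn
      have := hzero ((φ n).normed volume) (φ n).contDiff_normed (φ n).hasCompactSupport_normed (by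
        rw [(φ n).support_normed_eq]
        exact Metric.ball_subset_closedBall.trans (Metric.closedBall_subset_closedBall hn.le))
      simpa [convolution_def] using this
    have := tendsto_nhds_unique (tendsto_const_nhds.congr' (hev.mono fun n hn => hn.symm)) hlim
    simpa using this.symm
  have j₁ := integrable_mul_translate h₁ hga 0
  have j₂ := integrable_mul_translate h₂ hgb 0
  simp only [H, sub_zero] at hH0 j₁ j₂
  have hsub : ∫ x in Ω, (f₁ x * ga x - f₂ x * gb x) =
      (∫ x, Ω.indicator f₁ x * ga x) - ∫ x, Ω.indicator f₂ x * gb x := by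
    rw [← integral_sub j₁ j₂, ← integral_indicator hm]
    refine integral_congr_ae (.of_forall fun x => ?_)
    by_cases hx : x ∈ Ω <;> simp [hx]
  rw [hsub, ← integral_indicator_mul hm f₃]
  linarith

theorem continuous_pd {φ : E3 → ℝ} (hφ : ContDiff ℝ ∞ φ) (i : Fin 3) : Continuous (pd i φ) :=
  (hφ.continuous_fderiv (by simp)).clm_apply continuous_const

theorem hasCompactSupport_pd {φ : E3 → ℝ} (hφ : HasCompactSupport φ) (i : Fin 3) :
    HasCompactSupport (pd i φ) :=
  hφ.fderiv_apply ℝ _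

theorem support_pd_subset (φ : E3 → ℝ) (i : Fin 3) : Function.support (pd i φ) ⊆ tsupport φ :=
  fun x hx => support_fderiv_subset ℝ (f := φ) fun h => hx (by simp [pd, h])

theorem pd_mul {φ χ : E3 → ℝ} (hφ : ContDiff ℝ ∞ φ) (hχ : ContDiff ℝ ∞ χ) (i : Fin 3) (x : E3) :
    pd i (fun x => φ x * χ x) x = φ x * pd i χ x + χ x * pd i φ x := by
  rw [pd, fderiv_fun_mul (hφ.differentiable (by simp) x) (hχ.differentiable (by simp) x)]
  simp [pd]

theorem memLp_mul_of_continuous {q : ENNReal} {μ : Measure E3} {u k : E3 → ℝ} (hu : MemLp u q μ)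
    (hk : Continuous k) (hkc : HasCompactSupport k) : MemLp (fun x => u x * k x) q μ := by
  obtain ⟨C, hC⟩ := hk.bounded_above_of_compact_support hkc
  have : MemLp k ⊤ μ := memLp_top_of_bound hk.aestronglyMeasurable C (.of_forall hC)
  exact this.mul' hu

theorem integrable_mul_of_continuous {Ω : Set E3} {u k : E3 → ℝ} (hu : LocallyIntegrableOn u Ω)
    (hk : Continuous k) (hkc : HasCompactSupport k) (hkΩ : tsupport k ⊆ Ω) :
    IntegrableOn (fun x => u x * k x) Ω := by
  have h1 : IntegrableOn (fun x => u x * k x) (tsupport k) :=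
    (hu.integrableOn_compact_subset hkΩ hkc.isCompact).mul_continuousOn hk.continuousOn
      hkc.isCompact
  have h2 : Integrable (fun x => u x * k x) :=
    (integrableOn_iff_integrable_of_support_subset fun x hx => by
      refine subset_tsupport k fun h => hx (by simp [h])).1 h1
  exact h2.integrableOn

/-- Product of a Sobolev function with a test function, extended by zero. -/
theorem HasWeakPartial.indicator_mul_test {Ω : Set E3} (hΩ : IsOpen Ω) {q : ENNReal} (hq : 1 ≤ q)
    {i : Fin 3} {u g φ : E3 → ℝ} (hu : MemLp u q (volume.restrict Ω))
    (hg : MemLp g q (volume.restrict Ω)) (h : HasWeakPartial Ω i u g) (hφ : IsTest Ω φ) :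
    MemLp (fun x => Ω.indicator u x * φ x) q ∧
    MemLp (fun x => Ω.indicator g x * φ x + Ω.indicator u x * pd i φ x) q ∧
    HasWeakPartial Set.univ i (fun x => Ω.indicator u x * φ x)
      (fun x => Ω.indicator g x * φ x + Ω.indicator u x * pd i φ x) := by
  have hm := hΩ.measurableSet
  have hu' := (memLp_indicator_iff_restrict hm).2 hu
  have hg' := (memLp_indicator_iff_restrict hm).2 hg
  have m1 := memLp_mul_of_continuous hu' hφ.1.continuous hφ.2.1
  have m2 := (memLp_mul_of_continuous hg' hφ.1.continuous hφ.2.1).add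
    (memLp_mul_of_continuous hu' (continuous_pd hφ.1 i) (hasCompactSupport_pd hφ.2.1 i))
  refine ⟨m1, m2, (m1.locallyIntegrable hq).locallyIntegrableOn _,
    (m2.locallyIntegrable hq).locallyIntegrableOn _, fun χ hχ => ?_⟩
  -- The factor `φ` keeps the support in `Ω`, although `χ` is a test function on the whole space.
  have htest : IsTest Ω fun x => φ x * χ x :=
    ⟨hφ.1.mul hχ.1, hφ.2.1.mul_right, (tsupport_mul_subset_left).trans hφ.2.2⟩
  have hw := h.2.2 _ htest
  simp only [pd_mul hφ.1 hχ.1, Measure.restrict_univ] at hw ⊢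
  have I : ∀ {v k : E3 → ℝ}, MemLp v q → Continuous k → HasCompactSupport k →
      Integrable fun x => v x * k x := fun hv hk hkc => by
    simpa only [smul_eq_mul, mul_comm] using
      (hv.locallyIntegrable hq).integrable_smul_left_of_hasCompactSupport hk hkc
  have i1 : Integrable fun x => Ω.indicator u x * (φ x * pd i χ x) :=
    I hu' (hφ.1.continuous.mul (continuous_pd hχ.1 i)) hφ.2.1.mul_right
  have i2 : Integrable fun x => Ω.indicator u x * (χ x * pd i φ x) :=
    I hu' (hχ.1.continuous.mul (continuous_pd hφ.1 i)) hχ.2.1.mul_right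
  have i3 : Integrable fun x => Ω.indicator g x * (φ x * χ x) :=
    I hg' (hφ.1.continuous.mul hχ.1.continuous) hφ.2.1.mul_right
  rw [← integral_indicator_mul hm u, ← integral_indicator_mul hm g] at hw
  simp only [mul_add] at hw
  rw [integral_add i1 i2] at hw
  have e2 : ∫ x, (Ω.indicator g x * φ x + Ω.indicator u x * pd i φ x) * χ x =
      (∫ x, Ω.indicator g x * (φ x * χ x)) + ∫ x, Ω.indicator u x * (χ x * pd i φ x) := by
    rw [← integral_add i3 i2]
    refine integral_congr_ae (.of_forall fun x => ?_)
    simp only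
    ring
  rw [e2]
  simp only [mul_assoc]
  linarith

/-- The product rule `curl (u y) = ∇u × y + u curl y`. -/
theorem HasWeakCurlVec.smul {Ω : Set E3} (hΩ : IsOpen Ω) {p q : ENNReal} [p.HolderConjugate q]
    (hq : q ≠ ⊤) {u : E3 → ℝ} {g y z : E3 → Fin 3 → ℝ}
    (hu : MemLp u q (volume.restrict Ω))
    (hg : ∀ i, MemLp (fun x => g x i) q (volume.restrict Ω))
    (hug : ∀ i, HasWeakPartial Ω i u fun x => g x i)
    (hy : ∀ i, MemLp (fun x => y x i) p (volume.restrict Ω))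
    (hz : ∀ i, MemLp (fun x => z x i) p (volume.restrict Ω)) (hyz : HasWeakCurlVec Ω y z) :
    HasWeakCurlVec Ω (fun x k => u x * y x k) (fun x k =>
      g x (k + 1) * y x (k + 2) - g x (k + 2) * y x (k + 1) + u x * z x k) := by
  have hq1 : 1 ≤ q := ENNReal.HolderConjugate.one_le q p
  have L : ∀ {v w : E3 → ℝ}, MemLp v q (volume.restrict Ω) → MemLp w p (volume.restrict Ω) →
      Integrable (fun x => v x * w x) (volume.restrict Ω) := fun hv hw => hv.integrable_mul hw
  have hint : ∀ k, Integrable (fun x => g x (k + 1) * y x (k + 2) - g x (k + 2) * y x (k + 1) +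
      u x * z x k) (volume.restrict Ω) := fun k =>
    ((L (hg _) (hy _)).sub (L (hg _) (hy _))).add (L hu (hz k))
  refine ⟨fun k => IntegrableOn.locallyIntegrableOn (L hu (hy k)),
    fun k => IntegrableOn.locallyIntegrableOn (hint k), fun k φ hφ => ?_⟩
  obtain ⟨mψ, ma, wa⟩ := (hug (k + 1)).indicator_mul_test hΩ hq1 hu (hg _) hφ
  obtain ⟨-, mb, wb⟩ := (hug (k + 2)).indicator_mul_test hΩ hq1 hu (hg _) hφ
  have key := integral_eq_of_forall_isTest hΩ hq (hy (k + 2)) (hy (k + 1)) (hz k)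
    (hyz.2.2 k) mψ ma mb wa wb hφ.2.1.mul_left (tsupport_mul_subset_right.trans hφ.2.2)
  have B : ∀ {v χ : E3 → ℝ}, Integrable v (volume.restrict Ω) → Continuous χ →
      HasCompactSupport χ → Integrable (fun x => v x * χ x) (volume.restrict Ω) :=
    fun hv hχ hχc => memLp_one_iff_integrable.1
      (memLp_mul_of_continuous (memLp_one_iff_integrable.2 hv) hχ hχc)
  have iL : Integrable (fun x => u x * y x (k + 2) * pd (k + 1) φ x -
      u x * y x (k + 1) * pd (k + 2) φ x) (volume.restrict Ω) :=
    (B (L hu (hy _)) (continuous_pd hφ.1 _) (hasCompactSupport_pd hφ.2.1 _)).sub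
      (B (L hu (hy _)) (continuous_pd hφ.1 _) (hasCompactSupport_pd hφ.2.1 _))
  have iG : Integrable (fun x => (g x (k + 1) * y x (k + 2) - g x (k + 2) * y x (k + 1)) * φ x)
      (volume.restrict Ω) :=
    B ((L (hg _) (hy _)).sub (L (hg _) (hy _))) hφ.1.continuous hφ.2.1
  have iZ : Integrable (fun x => u x * z x k * φ x) (volume.restrict Ω) :=
    B (L hu (hz k)) hφ.1.continuous hφ.2.1
  have e1 : ∫ x in Ω, (y x (k + 2) * (Ω.indicator (fun x => g x (k + 1)) x * φ x +
        Ω.indicator u x * pd (k + 1) φ x) -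
      y x (k + 1) * (Ω.indicator (fun x => g x (k + 2)) x * φ x +
        Ω.indicator u x * pd (k + 2) φ x)) =
      (∫ x in Ω, (u x * y x (k + 2) * pd (k + 1) φ x - u x * y x (k + 1) * pd (k + 2) φ x)) +
      ∫ x in Ω, (g x (k + 1) * y x (k + 2) - g x (k + 2) * y x (k + 1)) * φ x := by
    rw [← integral_add iL iG]
    refine setIntegral_congr_fun hΩ.measurableSet fun x hx => ?_
    simp only [Set.indicator_of_mem hx]
    ring
  have e2 : ∫ x in Ω, z x k * (Ω.indicator u x * φ x) = ∫ x in Ω, u x * z x k * φ x := by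
    refine setIntegral_congr_fun hΩ.measurableSet fun x hx => ?_
    simp only [Set.indicator_of_mem hx]
    ring
  have e3 : ∫ x in Ω, (g x (k + 1) * y x (k + 2) - g x (k + 2) * y x (k + 1) + u x * z x k) * φ x =
      (∫ x in Ω, (g x (k + 1) * y x (k + 2) - g x (k + 2) * y x (k + 1)) * φ x) +
      ∫ x in Ω, u x * z x k * φ x := by
    rw [← integral_add iG iZ]
    refine integral_congr_ae (.of_forall fun x => ?_)
    simp only
    ring
  rw [e1, e2] at key
  rw [e3]
  linarith

/-- The fundamental lemma of the calculus of variations. It makes weak derivatives and curls unique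
a.e., so integrability of one representative passes to any other. -/
theorem ae_eq_of_forall_isTest {Ω : Set E3} (hΩ : IsOpen Ω) {f g : E3 → ℝ}
    (hf : LocallyIntegrableOn f Ω) (hg : LocallyIntegrableOn g Ω)
    (h : ∀ φ, IsTest Ω φ → ∫ x in Ω, f x * φ x = ∫ x in Ω, g x * φ x) :
    f =ᵐ[volume.restrict Ω] g := by
  have := hΩ.ae_eq_zero_of_integral_contDiff_smul_eq_zero (hf.sub hg) (μ := volume)
    fun φ h1 h2 h3 => by
      have i1 := integrable_mul_of_continuous hf h1.continuous h2 h3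
      have i2 := integrable_mul_of_continuous hg h1.continuous h2 h3
      have e := h φ ⟨h1, h2, h3⟩
      rw [← sub_eq_zero, ← integral_sub i1 i2] at e
      rw [← e, ← integral_indicator hΩ.measurableSet]
      refine integral_congr_ae (.of_forall fun x => ?_)
      by_cases hx : x ∈ Ω
      · simp [hx]; ring
      · have : φ x = 0 := image_eq_zero_of_notMem_tsupport fun h => hx (h3 h)
        simp [hx, this]
  rw [Filter.EventuallyEq, ae_restrict_iff' hΩ.measurableSet]
  filter_upwards [this] with x hx hxΩ
  exact sub_eq_zero.1 (hx hxΩ)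

theorem HasWeakPartial.ae_eq {Ω : Set E3} (hΩ : IsOpen Ω) {i : Fin 3} {u g g' : E3 → ℝ}
    (h : HasWeakPartial Ω i u g) (h' : HasWeakPartial Ω i u g') :
    g =ᵐ[volume.restrict Ω] g' :=
  ae_eq_of_forall_isTest hΩ h.2.1 h'.2.1 fun φ hφ => by
    linarith [h.2.2 φ hφ, h'.2.2 φ hφ]

theorem HasWeakCurlVec.ae_eq {Ω : Set E3} (hΩ : IsOpen Ω) {v w w' : E3 → Fin 3 → ℝ}
    (h : HasWeakCurlVec Ω v w) (h' : HasWeakCurlVec Ω v w') (k : Fin 3) :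
    (fun x => w x k) =ᵐ[volume.restrict Ω] fun x => w' x k :=
  ae_eq_of_forall_isTest hΩ (h.2.1 k) (h'.2.1 k) fun φ hφ => by
    linarith [h.2.2 k φ hφ, h'.2.2 k φ hφ]

/-- Every weak partial derivative of a function in `W^{1,p}` is in `Lᵖ`. -/
theorem MemW1.memLp_of_hasWeakPartial {Ω : Set E3} (hΩ : IsOpen Ω) {p : ENNReal} {i : Fin 3}
    {u g : E3 → ℝ} (hu : MemW1 Ω p u) (h : HasWeakPartial Ω i u g) :
    MemLp g p (volume.restrict Ω) := by
  obtain ⟨g', hg', hw⟩ := hu.2 i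
  exact hg'.ae_eq (hw.ae_eq hΩ h)

theorem HasWeakPartial.neg {Ω : Set E3} {i : Fin 3} {u g : E3 → ℝ} (h : HasWeakPartial Ω i u g) :
    HasWeakPartial Ω i (fun x => -u x) (fun x => -g x) :=
  ⟨h.1.neg, h.2.1.neg, fun φ hφ => by
    simp only [neg_mul, integral_neg, h.2.2 φ hφ]⟩

theorem MemW1.neg {Ω : Set E3} {p : ENNReal} {u : E3 → ℝ} (h : MemW1 Ω p u) :
    MemW1 Ω p fun x => -u x :=
  ⟨h.1.neg, fun i => by
    obtain ⟨g, hg, hw⟩ := h.2 i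
    exact ⟨_, hg.neg, hw.neg⟩⟩

theorem HasWeakPartial.congr {Ω : Set E3} {i : Fin 3} {u u' g : E3 → ℝ}
    (h : HasWeakPartial Ω i u g) (huu : u =ᵐ[volume.restrict Ω] u') : HasWeakPartial Ω i u' g :=
  ⟨h.1.congr huu, h.2.1, fun φ hφ => by
    rw [← h.2.2 φ hφ]
    refine integral_congr_ae ?_
    filter_upwards [huu] with x hx
    rw [hx]⟩

theorem hasWeakPartial_zero (Ω : Set E3) (i : Fin 3) :
    HasWeakPartial Ω i (fun _ => 0) fun _ => 0 :=
  ⟨locallyIntegrableOn_zero, locallyIntegrableOn_zero, fun φ _ => by simp⟩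

theorem HasWeakCurlVec.add {Ω : Set E3} {v v' w w' : E3 → Fin 3 → ℝ}
    (h : HasWeakCurlVec Ω v w) (h' : HasWeakCurlVec Ω v' w') :
    HasWeakCurlVec Ω (fun x k => v x k + v' x k) (fun x k => w x k + w' x k) := by
  refine ⟨fun k => (h.1 k).add (h'.1 k), fun k => (h.2.1 k).add (h'.2.1 k), fun k φ hφ => ?_⟩
  have I : ∀ {f : E3 → ℝ}, LocallyIntegrableOn f Ω → Integrable (fun x => f x * φ x)
      (volume.restrict Ω) := fun hf =>
    integrable_mul_of_continuous hf hφ.1.continuous hφ.2.1 hφ.2.2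
  have J : ∀ {f : E3 → ℝ} (i : Fin 3), LocallyIntegrableOn f Ω →
      Integrable (fun x => f x * pd i φ x) (volume.restrict Ω) := fun i hf =>
    integrable_mul_of_continuous hf (continuous_pd hφ.1 i) (hasCompactSupport_pd hφ.2.1 i)
      ((closure_minimal (support_pd_subset φ i) (isClosed_tsupport φ)).trans hφ.2.2)
  simp only [add_mul]
  have K : ∀ {f : E3 → Fin 3 → ℝ}, (∀ k, LocallyIntegrableOn (fun x => f x k) Ω) →
      Integrable (fun x => f x (k + 2) * pd (k + 1) φ x - f x (k + 1) * pd (k + 2) φ x)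
        (volume.restrict Ω) := fun hf => (J _ (hf _)).sub (J _ (hf _))
  rw [integral_add (I (h.2.1 k)) (I (h'.2.1 k)), neg_add, ← h.2.2 k φ hφ, ← h'.2.2 k φ hφ,
    ← integral_add (K h.1) (K h'.1)]
  refine integral_congr_ae (.of_forall fun x => ?_)
  simp only
  ring

end NeffCurl

/-! ### The block matrices as cross products. -/

namespace NeffCurl
open Matrix

theorem mat_blocks_mulVec_vec (B : Matrix (Fin 3) (Fin 3) M3) (A : M3) (i a : Fin 3) :
    mat (blocks B *ᵥ vec A) i a = ∑ j, (B i j *ᵥ A.row j) a := by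
  simp only [mat, Matrix.of_apply, mulVec, dotProduct]
  rw [← Equiv.sum_comp (finProdFinEquiv (m := 3) (n := 3)), Fintype.sum_prod_type]
  simp [blocks, vec]

theorem smat_mulVec (y z : Fin 3 → ℝ) (k : Fin 3) :
    (smat y *ᵥ z) k = y (k + 1) * z (k + 2) - y (k + 2) * z (k + 1) := by
  fin_cases k <;> simp [smat, mulVec, dotProduct, Fin.sum_univ_three] <;> ring

theorem mat_add (a b : Fin 9 → ℝ) : mat (a + b) = mat a + mat b := rfl

theorem mat_neg (a : Fin 9 → ℝ) : mat (-a) = -mat a := rfl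

/-- The gradients of the entries of `X`, from the Jacobians of `dvec X`, `skvec X`, `symvec X`. -/
def entryGradient (D K S : M3) : Matrix (Fin 3) (Fin 3) (Fin 3 → ℝ) :=
  !![D.row 0, -K.row 2, K.row 1;
     S.row 2, D.row 1, -K.row 0;
     -S.row 1, S.row 0, D.row 2]

/-- A block `-smat yₙ` sends a gradient `z` to `z × yₙ`. Blocks with the opposite sign occur exactly
where `skvec` or `symvec` negates the entry of `X`. -/
theorem mat_mulVec_add_apply (Y D K S : M3) (l k : Fin 3) :
    mat (Ldiag Y *ᵥ vec D + Lskew Y *ᵥ vec K + Lsym Y *ᵥ vec S) l k =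
      ∑ n, (entryGradient D K S l n (k + 1) * Y n (k + 2) -
        entryGradient D K S l n (k + 2) * Y n (k + 1)) := by
  rw [Ldiag, Lskew, Lsym, Matrix.neg_mulVec, mat_add, mat_add, mat_neg, Matrix.add_apply,
    Matrix.add_apply, Matrix.neg_apply, mat_blocks_mulVec_vec, mat_blocks_mulVec_vec,
    mat_blocks_mulVec_vec]
  have h0 : ∀ n, Y n = Y.row n := fun _ => rfl
  simp only [h0, Fin.sum_univ_three]
  fin_cases l <;> simp [entryGradient, smat_mulVec, Matrix.neg_mulVec] <;> ring

end NeffCurl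

/-! ### The matrix product rule and the lemma. -/

namespace NeffCurl
open Matrix

theorem hasWeakCurlVec_finset_sum {Ω : Set E3} (v w : Fin 3 → E3 → Fin 3 → ℝ)
    (h : ∀ n, HasWeakCurlVec Ω (v n) (w n)) :
    HasWeakCurlVec Ω (fun x k => ∑ n, v n x k) (fun x k => ∑ n, w n x k) := by
  simpa only [Fin.sum_univ_three] using ((h 0).add (h 1)).add (h 2)

theorem HasWeakCurl.memLpMat {Ω : Set E3} (hΩ : IsOpen Ω) {p : ENNReal} {Y C : E3 → M3}
    (hY : MemWCurl Ω p Y) (hC : HasWeakCurl Ω Y C) : MemLpMat Ω p C := by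
  obtain ⟨-, Z, hZ, hYZ⟩ := hY
  exact fun l k => (hZ l k).ae_eq ((hYZ l).ae_eq hΩ (hC l) k)

/-- The product rule for the row-wise curl, in terms of the gradients of the entries of `X`. -/
theorem hasWeakCurl_mul {Ω : Set E3} (hΩ : IsOpen Ω) {p q : ENNReal} [p.HolderConjugate q]
    (hq : q ≠ ⊤) {X Y C : E3 → M3} (hX : ∀ i j, MemW1 Ω q fun x => X x i j)
    (hY : MemWCurl Ω p Y) (hC : HasWeakCurl Ω Y C)
    {G : E3 → Matrix (Fin 3) (Fin 3) (Fin 3 → ℝ)}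
    (hG : ∀ l n i, HasWeakPartial Ω i (fun x => X x l n) fun x => G x l n i) :
    HasWeakCurl Ω (fun x => X x * Y x) fun x => (Matrix.of fun l k =>
      ∑ n, (G x l n (k + 1) * Y x n (k + 2) - G x l n (k + 2) * Y x n (k + 1))) + X x * C x := by
  intro l
  have h := hasWeakCurlVec_finset_sum _ _ fun n =>
    HasWeakCurlVec.smul (p := p) hΩ hq (hX l n).1
      (fun i => (hX l n).memLp_of_hasWeakPartial hΩ (hG l n i)) (hG l n) (hY.1 n)
      (HasWeakCurl.memLpMat hΩ hY hC n) (hC n)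
  convert h using 3 with x k x k
  · rfl
  · rw [Finset.sum_add_distrib (M := ℝ)]
    rfl

theorem memLpMat_blocks {Ω : Set E3} {p : ENNReal} {B : E3 → Matrix (Fin 3) (Fin 3) M3}
    (h : ∀ i j a b, MemLp (fun x => B x i j a b) p (volume.restrict Ω)) :
    MemLpMat Ω p fun x => blocks (B x) := fun _ _ => h _ _ _ _

theorem memLp_smat {Ω : Set E3} {p : ENNReal} {y : E3 → Fin 3 → ℝ}
    (h : ∀ k, MemLp (fun x => y x k) p (volume.restrict Ω)) (a b : Fin 3) :
    MemLp (fun x => smat (y x) a b) p (volume.restrict Ω) := by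
  have z : MemLp (fun _ : E3 => (0 : ℝ)) p (volume.restrict Ω) := MemLp.zero
  fin_cases a <;> fin_cases b
  exacts [z, (h 2).neg, h 1, h 2, z, (h 0).neg, (h 1).neg, h 0, z]

end NeffCurl

theorem lemma4p1 (Ω : Set E3) (hΩ : IsOpen Ω) (r s : ℝ) (hr : 1 < r) (hs : 1 < s)
    (hrs : 1 / r + 1 / s = 1) (X Y : E3 → M3)
    (hX : ∀ i j, MemW1 Ω (ENNReal.ofReal r) (fun x => X x i j))
    (hY : MemWCurl Ω (ENNReal.ofReal s) Y) :
    -- `XY` lies in `W¹(Curl)`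
    MemWCurl Ω 1 (fun x => X x * Y x) ∧
    -- the coefficients are in `Lˢ`
    MemLpMat Ω (ENNReal.ofReal s) (fun x => Ldiag (Y x)) ∧
    MemLpMat Ω (ENNReal.ofReal s) (fun x => Lskew (Y x)) ∧
    MemLpMat Ω (ENNReal.ofReal s) (fun x => Lsym (Y x)) ∧
    -- the vector fields in the formula are weakly differentiable
    (∀ i, MemW1 Ω (ENNReal.ofReal r) (fun x => dvec (X x) i)) ∧
    (∀ i, MemW1 Ω (ENNReal.ofReal r) (fun x => skvec (X x) i)) ∧
    (∀ i, MemW1 Ω (ENNReal.ofReal r) (fun x => symvec (X x) i)) ∧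
    -- the formula for general `X`; `D, K, S` are the weak Jacobians, `C` is `Curl Y`
    (∀ D K S C : E3 → M3,
      HasWeakJacobian Ω (fun x => dvec (X x)) D →
      HasWeakJacobian Ω (fun x => skvec (X x)) K →
      HasWeakJacobian Ω (fun x => symvec (X x)) S →
      HasWeakCurl Ω Y C →
      HasWeakCurl Ω (fun x => X x * Y x) (fun x =>
        mat (Matrix.mulVec (Ldiag (Y x)) (vec (D x)) + Matrix.mulVec (Lskew (Y x)) (vec (K x))
          + Matrix.mulVec (Lsym (Y x)) (vec (S x))) + X x * C x)) ∧
    -- the formula for skew-symmetric `X`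
    ((∀ᵐ x ∂(volume.restrict Ω), (X x).transpose = -X x) →
      (∀ i, MemW1 Ω (ENNReal.ofReal r) (fun x => axl (X x) i)) ∧
      ∀ A C : E3 → M3,
        HasWeakJacobian Ω (fun x => axl (X x)) A →
        HasWeakCurl Ω Y C →
        HasWeakCurl Ω (fun x => X x * Y x) (fun x =>
          mat (Matrix.mulVec (LY (Y x)) (vec (A x))) + X x * C x)) ∧
    -- the determinant and the invertibility of `L_Y`
    (∀ M : M3, (LY M).det = -2 * M.det ^ 3) ∧
    (∀ M : M3, IsUnit M → IsUnit (LY M)) := by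
  have hsr : s.HolderConjugate r := by
    rw [Real.holderConjugate_iff]
    exact ⟨hs, by simp only [one_div] at hrs; linarith⟩
  have := hsr.ennrealOfReal
  have hq : ENNReal.ofReal r ≠ ⊤ := ENNReal.ofReal_ne_top
  have zero_memLp : MemLp (fun _ : E3 => (0 : ℝ)) (ENNReal.ofReal s) (volume.restrict Ω) :=
    MemLp.zero
  have hS : ∀ n a b, MemLp (fun x => smat (Y x n) a b) (ENNReal.ofReal s) (volume.restrict Ω) :=
    fun n => memLp_smat (hY.1 n)
  have formula : ∀ D K S C : E3 → M3,
      HasWeakJacobian Ω (fun x => dvec (X x)) D →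
      HasWeakJacobian Ω (fun x => skvec (X x)) K →
      HasWeakJacobian Ω (fun x => symvec (X x)) S →
      HasWeakCurl Ω Y C →
      HasWeakCurl Ω (fun x => X x * Y x) (fun x =>
        mat (Matrix.mulVec (Ldiag (Y x)) (vec (D x)) + Matrix.mulVec (Lskew (Y x)) (vec (K x))
          + Matrix.mulVec (Lsym (Y x)) (vec (S x))) + X x * C x) := by
    intro D K S C hD hK hSy hC
    have h := hasWeakCurl_mul (G := fun x => entryGradient (D x) (K x) (S x)) hΩ hq hX hY hC <| by
      have neg : ∀ {i : Fin 3} {u g : E3 → ℝ}, HasWeakPartial Ω i (fun x => -u x) g →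
          HasWeakPartial Ω i u fun x => -g x := fun h => by simpa only [neg_neg] using h.neg
      intro l n i
      fin_cases l <;> fin_cases n
      exacts [hD 0 i, neg (hK 2 i), hK 1 i, hSy 2 i, hD 1 i, neg (hK 0 i), neg (hSy 1 i), hSy 0 i,
        hD 2 i]
    convert h using 4 with x
    ext l k
    exact mat_mulVec_add_apply (Y x) (D x) (K x) (S x) l k
  refine ⟨?_, ?_, ?_, ?_, ?_, ?_, ?_, formula, ?_, det_LY, ?_⟩
  · obtain ⟨Z, hZ, hYZ⟩ := hY.2
    -- Membership in `W¹(Curl)` needs only some `L^r` gradients of the entries of `X`; Hölder then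
    -- puts the curl in `L¹`.
    choose G hG hXG using fun l n => (hX l n).2
    have L : ∀ {u v : E3 → ℝ}, MemLp u (ENNReal.ofReal r) (volume.restrict Ω) →
        MemLp v (ENNReal.ofReal s) (volume.restrict Ω) →
        MemLp (fun x => u x * v x) 1 (volume.restrict Ω) := fun hu hv =>
      memLp_one_iff_integrable.2 (hu.integrable_mul hv)
    have P : ∀ {V : E3 → M3}, MemLpMat Ω (ENNReal.ofReal s) V →
        MemLpMat Ω 1 fun x => X x * V x := fun hV i k => by
      simp only [Matrix.mul_apply]
      exact memLp_finsetSum _ fun n _ => L (hX i n).1 (hV n k)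
    refine ⟨P hY.1, _, ?_, hasWeakCurl_mul (G := fun x => Matrix.of fun l n i => G l n i x)
      hΩ hq hX hY hYZ hXG⟩
    intro l k
    exact MemLp.add (f := fun x => ∑ n, (G l n (k + 1) x * Y x n (k + 2) -
        G l n (k + 2) x * Y x n (k + 1)))
      (memLp_finsetSum _ fun n _ => (L (hG l n _) (hY.1 n _)).sub (L (hG l n _) (hY.1 n _)))
      (P hZ l k)
  · intro i j
    refine MemLp.neg (memLpMat_blocks (fun i j a b => ?_) i j)
    fin_cases i <;> fin_cases j
    exacts [hS 0 a b, zero_memLp, zero_memLp, zero_memLp, hS 1 a b, zero_memLp, zero_memLp,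
      zero_memLp, hS 2 a b]
  · refine memLpMat_blocks fun i j a b => ?_
    fin_cases i <;> fin_cases j
    exacts [zero_memLp, (hS 2 a b).neg, hS 1 a b, hS 2 a b, zero_memLp, zero_memLp, zero_memLp,
      zero_memLp, zero_memLp]
  · refine memLpMat_blocks fun i j a b => ?_
    fin_cases i <;> fin_cases j
    exacts [zero_memLp, zero_memLp, zero_memLp, zero_memLp, zero_memLp, (hS 0 a b).neg,
      (hS 1 a b).neg, hS 0 a b, zero_memLp]
  · intro i
    fin_cases i
    exacts [hX 0 0, hX 1 1, hX 2 2]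
  · intro i
    fin_cases i
    exacts [(hX 1 2).neg, hX 0 2, (hX 0 1).neg]
  · intro i
    fin_cases i
    exacts [hX 2 1, (hX 2 0).neg, hX 1 0]
  · intro hskew
    refine ⟨fun i => ?_, fun A C hA hC => ?_⟩
    · fin_cases i
      exacts [hX 2 1, hX 0 2, hX 1 0]
    have hent : ∀ᵐ x ∂(volume.restrict Ω), ∀ i j, X x j i = -X x i j := by
      filter_upwards [hskew] with x hx i j using congrFun (congrFun hx i) j
    -- For skew `X`, a.e. `dvec X = 0` and `skvec X = symvec X = axl X`. The diagonal term drops out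
    -- and the other two share the Jacobian `A`, so their coefficients add up to `L_Y`.
    have hd : HasWeakJacobian Ω (fun x => dvec (X x)) fun _ => 0 := fun i j =>
      (hasWeakPartial_zero Ω j).congr <| by
        filter_upwards [hent] with x hx
        fin_cases i <;> simp [dvec] <;> linarith [hx 0 0, hx 1 1, hx 2 2]
    have hk : HasWeakJacobian Ω (fun x => skvec (X x)) A := fun i j =>
      (hA i j).congr <| by
        filter_upwards [hent] with x hx
        fin_cases i <;> simp [skvec, axl] <;> linarith [hx 1 2, hx 0 1]
    have hsy : HasWeakJacobian Ω (fun x => symvec (X x)) A := fun i j =>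
      (hA i j).congr <| by
        filter_upwards [hent] with x hx
        fin_cases i <;> simp [symvec, axl] <;> linarith [hx 2 0]
    have h := formula _ _ _ C hd hk hsy hC
    have hv : vec 0 = 0 := rfl
    simpa only [LY, Matrix.add_mulVec, hv, Matrix.mulVec_zero, zero_add] using h
  · intro M hM
    rw [Matrix.isUnit_iff_isUnit_det] at hM ⊢
    rw [det_LY]
    exact (isUnit_iff_ne_zero.2 (by norm_num)).mul (hM.pow 3)
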